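/- Let $(\mathcal C,\mathbb E,\mathfrak s)$ be an extriangulated category in the sense of Nakaoka and Palu ($\mathcal C$ additive, $\mathbb E:\mathcal C^{op}\times\mathcal C\to \mathrm{Ab}$ an additive bifunctor, $\mathfrak s$ an additive realization, satisfying (ET3), (ET3)$^{op}$, (ET4), (ET4)$^{op}$), and write $a\cdot\eta=\mathbb E(-,a)(\eta)$, $\eta\cdot c=\mathbb E(c,-)(\eta)$. A conflation is a sequence $A\to B\to C$ with $\mathfrak s(\delta)=[A\to B\to C]$ for some $\delta\in\mathbb E(C,A)$; a morphism $\delta\to\delta'$, for $\delta\in\mathbb E(C,A)$ and $\delta'\in\mathbb E(C',A')$, is a pair $(a:A\to A',\,c:C\to C')$ with $a\cdot\delta=\delta'\cdot c$. A *negative first extension* on $\mathcal C$ is an additive bifunctor $\mathbb E^{-1}:\mathcal C^{op}\times\mathcal C\to\mathrm{Ab}$ together with, for each $\delta\in\mathbb E(C,A)$, natural transformations $\mathbb E^{-1}(-,C)\to\mathrm{Hom}(-,A)$ and $\mathbb E^{-1}(A,-)\to\mathrm{Hom}(C,-)$, compatible with morphisms of extensions $\delta\to\delta'$, such that for every $A\xrightarrow{x}B\xrightarrow{y}C$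 realizing $\delta$ and every object $W$ the sequences $$\mathbb E^{-1}(W,A)\to\mathbb E^{-1}(W,B)\to\mathbb E^{-1}(W,C)\to\mathrm{Hom}(W,A)\xrightarrow{x\circ-}\mathrm{Hom}(W,B),$$ $$\mathbb E^{-1}(C,W)\to\mathbb E^{-1}(B,W)\to\mathbb E^{-1}(A,W)\to\mathrm{Hom}(C,W)\xrightarrow{-\circ y}\mathrm{Hom}(B,W)$$ are exact. $\mathcal C$ is *coproduct-compatible* if it has coproducts indexed by all non-empty sets and carries a negative first extension such that, for every object $X$, every non-empty set $I$ and every family $(Y_i)_{i\in I}$ of objects, the map $\mathbb E^{-1}(\coprod_i Y_i,X)\to\prod_i\mathbb E^{-1}(Y_i,X)$ induced by the canonical inclusions is surjective. It is *product-compatible* if it has products indexed by all non-empty sets and carries a negative first extension such that $\mathbb E^{-1}(X,\prod_i Y_i)\to\prod_i\mathbb E^{-1}(X,Y_i)$, induced by the projections, is always surjective. $\mathcal C$ is *AET4* if for every non-empty set $I$ all coproducts indexed by $I$ exist and there is a natural transformation (of abelian groups, natural in the family $(B_i)_{i\in I}$ and in $A$) $$\Gamma:\prod_{i\in I}\mathbb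 E(B_i,A)\to\mathbb E\Big(\coprod_{i\in I}B_i,A^{(I)}\Big)$$ such that (1) if $\eta_i$ is realized by $A\xrightarrow{f_i}E_i\xrightarrow{g_i}B_i$ for all $i$, then $\Gamma((\eta_i)_i)$ is realized by $A^{(I)}\xrightarrow{\coprod f_i}\coprod E_i\xrightarrow{\coprod g_i}\coprod B_i$; and (2) $\Gamma((\eta_i)_i)\cdot\mu^B_i=\mu_i^A\cdot\eta_i$ for all $i$, where $\mu_i^B:B_i\to\coprod_j B_j$ and $\mu_i^A:A\to A^{(I)}$ are the canonical inclusions. $\mathcal C$ is *AET4\** if $\mathcal C^{op}$, with the opposite extriangulated structure, is AET4. An object $J$ is $\mathbb E$-injective if for every conflation $A\to B\to C$ every morphism $A\to J$ factors through $A\to B$; $\mathcal C$ has enough $\mathbb E$-injectives if every object $A$ admits a conflation $A\to J\to C$ with $J$ $\mathbb E$-injective. $\mathbb E$-projectives, and having enough of them, are defined dually. **Corollary.** If $(\mathcal C,\mathbb E,\mathfrak s)$ is coproduct-compatible and has enough $\mathbb E$-injectives, then it is AET4. If it is product-compatible and has enough $\mathbb E$-projectives, then it is AET4\*. -/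

import Mathlib

open CategoryTheory CategoryTheory.Limits Opposite

universe v u

namespace Extri

section Bifunctors

variable {C : Type u} [Category.{v} C] [Preadditive C]

/-- An additive bifunctor from `Cᵒᵖ × C` to abelian groups (in curried form). -/
structure AddBifunctor (C : Type u) [Category.{v} C] [Preadditive C] where
  functor : Cᵒᵖ ⥤ C ⥤ AddCommGrpCat.{v}
  additive_left : functor.Additive
  additive_right : ∀ Z : Cᵒᵖ, (functor.obj Z).Additive

namespace AddBifunctor

/-- The abelian group `F(Z, X)`, contravariant in `Z` and covariant in `X`. -/
abbrev Grp (F : AddBifunctor C) (Z X : C) : Type v := (F.functor.obj (op Z)).obj X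

/-- `a · x = F(Z, a)(x)`. -/
def push (F : AddBifunctor C) {Z X X' : C} (a : X ⟶ X') : F.Grp Z X →+ F.Grp Z X' :=
  ((F.functor.obj (op Z)).map a).hom

/-- `x · c = F(c, X)(x)`. -/
def pull (F : AddBifunctor C) {Z Z' X : C} (c : Z' ⟶ Z) : F.Grp Z X →+ F.Grp Z' X :=
  ((F.functor.map c.op).app X).hom

/-- The bifunctor on `Cᵒᵖ` given by `(Z, X) ↦ F(X.unop, Z.unop)`. -/
def op (F : AddBifunctor C) : AddBifunctor Cᵒᵖ where
  functor := unopUnop C ⋙ F.functor.flip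
  additive_left := by
    refine ⟨?_⟩
    intro X Y f g
    ext Z x
    have := (F.additive_right Z).map_add (f := f.unop.unop) (g := g.unop.unop)
    exact congrArg (fun t => t.hom x) this
  additive_right := by
    intro Z
    refine ⟨?_⟩
    intro X Y f g
    ext x
    have := F.additive_left.map_add (f := f) (g := g)
    exact congrArg (fun t => (t.app _).hom x) this

end AddBifunctor

end Bifunctors

section Sequences

variable {C : Type u} [Category.{v} C]

/-- A sequence of morphisms `X ⟶ mid ⟶ Z`. -/
structure Seq (X Z : C) where
  mid : C
  i : X ⟶ mid
  p : mid ⟶ Z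

/-- Two sequences with the same ends are equivalent if there is an isomorphism of the middle
terms which is compatible with the identities of the ends. -/
instance Seq.setoid (X Z : C) : Setoid (Seq X Z) where
  r S T := ∃ b : S.mid ≅ T.mid, S.i ≫ b.hom = T.i ∧ b.hom ≫ T.p = S.p
  iseqv :=
    { refl := fun S => ⟨Iso.refl _, by simp, by simp⟩
      symm := by
        rintro S T ⟨b, h₁, h₂⟩
        exact ⟨b.symm, by simp [← h₁], by simp [← h₂]⟩
      trans := by
        rintro S T U ⟨b, h₁, h₂⟩ ⟨c, h₃, h₄⟩
        exact ⟨b ≪≫ c, by simp [← h₃, ← h₁], by simp [h₂, h₄]⟩ }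

/-- Equivalence classes of sequences from `X` to `Z`. -/
abbrev SeqClass (X Z : C) : Type (max u v) := Quotient (Seq.setoid X Z)

/-- The class `[X ⟶ Y ⟶ Z]`. -/
def seqClass {X Y Z : C} (i : X ⟶ Y) (p : Y ⟶ Z) : SeqClass X Z := ⟦⟨Y, i, p⟩⟧

/-- Reversing arrows: the class in `Cᵒᵖ` of the opposite of a sequence. -/
def SeqClass.op {X Z : C} : SeqClass X Z → SeqClass (Opposite.op Z) (Opposite.op X) :=
  Quotient.map (fun S => ⟨Opposite.op S.mid, S.p.op, S.i.op⟩) (by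
    rintro S T ⟨b, h₁, h₂⟩
    refine ⟨b.symm.op, ?_, ?_⟩
    · simp [← h₂, ← op_comp]
    · simp [← h₁, ← op_comp])

end Sequences

/-- An additive bifunctor together with an assignment `s` of a class of sequences
`X ⟶ Y ⟶ Z` to every extension `δ ∈ 𝔼(Z, X)`. -/
structure ExtData (C : Type u) [Category.{v} C] [Preadditive C] where
  E : AddBifunctor.{v} C
  s : ∀ {Z X : C}, E.Grp Z X → SeqClass X Z

namespace ExtData

variable {C : Type u} [Category.{v} C] [Preadditive C]

/-- `δ` is realized by `X ⟶ Y ⟶ Z`, that is, `s δ = [X ⟶ Y ⟶ Z]`. -/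
def Realizes (𝓓 : ExtData C) {X Y Z : C} (δ : 𝓓.E.Grp Z X) (i : X ⟶ Y) (p : Y ⟶ Z) : Prop :=
  𝓓.s δ = seqClass i p

/-- `X ⟶ Y ⟶ Z` is a conflation if it realizes some extension. -/
def IsConflation (𝓓 : ExtData C) {X Y Z : C} (i : X ⟶ Y) (p : Y ⟶ Z) : Prop :=
  ∃ δ : 𝓓.E.Grp Z X, 𝓓.Realizes δ i p

/-- `(a, c) : δ ⟶ δ'` is a morphism of extensions. -/
def IsExtHom (𝓓 : ExtData C) {X X' Z Z' : C} (δ : 𝓓.E.Grp Z X) (δ' : 𝓓.E.Grp Z' X')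
    (a : X ⟶ X') (c : Z ⟶ Z') : Prop :=
  𝓓.E.push a δ = 𝓓.E.pull c δ'

/-- The direct sum `δ ⊕ δ'`: the extension with diagonal components `δ`, `δ'` and
off-diagonal components zero. -/
noncomputable def sum (𝓓 : ExtData C) [HasBinaryBiproducts C] {X X' Z Z' : C}
    (δ : 𝓓.E.Grp Z X) (δ' : 𝓓.E.Grp Z' X') : 𝓓.E.Grp (Z ⊞ Z') (X ⊞ X') :=
  𝓓.E.push biprod.inl (𝓓.E.pull biprod.fst δ) + 𝓓.E.push biprod.inr (𝓓.E.pull biprod.snd δ')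

/-- The opposite data on `Cᵒᵖ`. -/
def op (𝓓 : ExtData C) : ExtData Cᵒᵖ where
  E := 𝓓.E.op
  s := fun {Z X} (δ : 𝓓.E.Grp X.unop Z.unop) => (𝓓.s δ).op

end ExtData

/-- An extriangulated category `(C, 𝔼, s)` (Nakaoka and Palu) on the additive category `C`.
The biadditivity of `𝔼` is part of `AddBifunctor`. -/
structure Extriangulated (C : Type u) [Category.{v} C] [Preadditive C] [HasZeroObject C]
    [HasBinaryBiproducts C] extends ExtData.{v} C where
  /-- `s` is a realization. -/
  realization : ∀ {X Y Z X' Y' Z' : C} {x : X ⟶ Y} {y : Y ⟶ Z} {x' : X' ⟶ Y'} {y' : Y' ⟶ Z'}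
    {δ : E.Grp Z X} {δ' : E.Grp Z' X'}, toExtData.Realizes δ x y → toExtData.Realizes δ' x' y' →
    ∀ (a : X ⟶ X') (c : Z ⟶ Z'), toExtData.IsExtHom δ δ' a c →
      ∃ b : Y ⟶ Y', x ≫ b = a ≫ x' ∧ y ≫ c = b ≫ y'
  /-- `s` sends zero to the class of the split sequence. -/
  real_zero : ∀ X Z : C, toExtData.Realizes (0 : E.Grp Z X)
    (biprod.inl : X ⟶ X ⊞ Z) (biprod.snd : X ⊞ Z ⟶ Z)
  /-- `s` is compatible with direct sums. -/
  real_sum : ∀ {X Y Z X' Y' Z' : C} {x : X ⟶ Y} {y : Y ⟶ Z} {x' : X' ⟶ Y'} {y' : Y' ⟶ Z'}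
    {δ : E.Grp Z X} {δ' : E.Grp Z' X'}, toExtData.Realizes δ x y → toExtData.Realizes δ' x' y' →
    toExtData.Realizes (toExtData.sum δ δ') (biprod.map x x') (biprod.map y y')
  et3 : ∀ {X Y Z X' Y' Z' : C} {x : X ⟶ Y} {y : Y ⟶ Z} {x' : X' ⟶ Y'} {y' : Y' ⟶ Z'}
    {δ : E.Grp Z X} {δ' : E.Grp Z' X'}, toExtData.Realizes δ x y → toExtData.Realizes δ' x' y' →
    ∀ (a : X ⟶ X') (b : Y ⟶ Y'), x ≫ b = a ≫ x' →
      ∃ c : Z ⟶ Z', toExtData.IsExtHom δ δ' a c ∧ y ≫ c = b ≫ y'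
  et3_op : ∀ {X Y Z X' Y' Z' : C} {x : X ⟶ Y} {y : Y ⟶ Z} {x' : X' ⟶ Y'} {y' : Y' ⟶ Z'}
    {δ : E.Grp Z X} {δ' : E.Grp Z' X'}, toExtData.Realizes δ x y → toExtData.Realizes δ' x' y' →
    ∀ (b : Y ⟶ Y') (c : Z ⟶ Z'), y ≫ c = b ≫ y' →
      ∃ a : X ⟶ X', toExtData.IsExtHom δ δ' a c ∧ x ≫ b = a ≫ x'
  et4 : ∀ {X Y Z U V : C} {f : X ⟶ Y} {f' : Y ⟶ U} {g : Y ⟶ Z} {g' : Z ⟶ V}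
    {δ : E.Grp U X} {δ' : E.Grp V Y}, toExtData.Realizes δ f f' → toExtData.Realizes δ' g g' →
    ∃ (W : C) (d : U ⟶ W) (e : W ⟶ V) (h' : Z ⟶ W) (δ'' : E.Grp W X),
      g ≫ h' = f' ≫ d ∧ h' ≫ e = g' ∧
      toExtData.Realizes δ'' (f ≫ g) h' ∧
      toExtData.Realizes (E.push f' δ') d e ∧
      E.pull d δ'' = δ ∧
      E.push f δ'' = E.pull e δ'
  et4_op : ∀ {X Y Z U V : C} {f' : U ⟶ X} {f : X ⟶ Y} {g' : V ⟶ Y} {g : Y ⟶ Z}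
    {δ : E.Grp Y U} {δ' : E.Grp Z V}, toExtData.Realizes δ f' f → toExtData.Realizes δ' g' g →
    ∃ (W : C) (d : U ⟶ W) (e : W ⟶ V) (h' : W ⟶ X) (δ'' : E.Grp Z W),
      d ≫ h' = f' ∧ h' ≫ f = e ≫ g' ∧
      toExtData.Realizes δ'' h' (f ≫ g) ∧
      toExtData.Realizes (E.pull g' δ) d e ∧
      E.push e δ'' = δ' ∧
      E.push d δ = E.pull g δ''

namespace ExtData

variable {C : Type u} [Category.{v} C] [Preadditive C]

/-- `J` is `𝔼`-injective: morphisms to `J` extend along every inflation. -/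
def IsInjective (𝓓 : ExtData C) (J : C) : Prop :=
  ∀ ⦃X Y Z : C⦄ (i : X ⟶ Y) (p : Y ⟶ Z), 𝓓.IsConflation i p →
    ∀ a : X ⟶ J, ∃ b : Y ⟶ J, i ≫ b = a

/-- `P` is `𝔼`-projective: morphisms from `P` lift along every deflation. -/
def IsProjective (𝓓 : ExtData C) (P : C) : Prop :=
  ∀ ⦃X Y Z : C⦄ (i : X ⟶ Y) (p : Y ⟶ Z), 𝓓.IsConflation i p →
    ∀ c : P ⟶ Z, ∃ b : P ⟶ Y, b ≫ p = c

def EnoughInjectives (𝓓 : ExtData C) : Prop :=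
  ∀ X : C, ∃ (J Z : C) (i : X ⟶ J) (p : J ⟶ Z), 𝓓.IsInjective J ∧ 𝓓.IsConflation i p

def EnoughProjectives (𝓓 : ExtData C) : Prop :=
  ∀ Z : C, ∃ (X P : C) (i : X ⟶ P) (p : P ⟶ Z), 𝓓.IsProjective P ∧ 𝓓.IsConflation i p

/-- For a nonempty set `I`: coproducts indexed by `I` exist, and there is a natural
transformation `Γ : ∏ᵢ 𝔼(Bᵢ, A) ⟶ 𝔼(∐ᵢ Bᵢ, A^(I))` of functors of the family `B` and of `A`
such that coproducts of realizations realize `Γ` and coproduct inclusions are morphisms of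
extensions. -/
def IsAET4For (𝓓 : ExtData C) (I : Type v) : Prop :=
  ∃ (_ : HasCoproductsOfShape I C)
    (Γ : ∀ (B : I → C) (A : C), (∀ i, 𝓓.E.Grp (B i) A) →+ 𝓓.E.Grp (∐ B) (∐ fun _ : I => A)),
    (∀ (B B' : I → C) (A A' : C) (b : ∀ i, B' i ⟶ B i) (a : A ⟶ A') (η : ∀ i, 𝓓.E.Grp (B i) A),
      Γ B' A' (fun i => 𝓓.E.push a (𝓓.E.pull (b i) (η i))) =
        𝓓.E.push (Limits.Sigma.map fun _ : I => a)
          (𝓓.E.pull (Limits.Sigma.map b) (Γ B A η))) ∧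
    (∀ (B : I → C) (A : C) (η : ∀ i, 𝓓.E.Grp (B i) A) (M : I → C)
      (f : ∀ i, A ⟶ M i) (g : ∀ i, M i ⟶ B i), (∀ i, 𝓓.Realizes (η i) (f i) (g i)) →
        𝓓.Realizes (Γ B A η) (Limits.Sigma.map f) (Limits.Sigma.map g)) ∧
    (∀ (B : I → C) (A : C) (η : ∀ i, 𝓓.E.Grp (B i) A) (i : I),
      𝓓.E.pull (Limits.Sigma.ι B i) (Γ B A η) =
        𝓓.E.push (Limits.Sigma.ι (fun _ : I => A) i) (η i))

/-- AET4. -/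
def IsAET4 (𝓓 : ExtData C) : Prop :=
  ∀ (I : Type v) [Nonempty I], 𝓓.IsAET4For I

/-- AET4*: the opposite category is AET4. -/
def IsAET4Star (𝓓 : ExtData C) : Prop :=
  𝓓.op.IsAET4

/-- A negative first extension structure: an additive bifunctor `𝔼⁻¹` with connecting
morphisms, natural in all arguments, which prolong the two long exact sequences of every
conflation one step to the left. -/
structure NegativeFirstExtension (𝓓 : ExtData C) where
  N : AddBifunctor.{v} C
  /-- `𝔼⁻¹(W, Z) ⟶ Hom(W, X)` for `δ ∈ 𝔼(Z, X)`. -/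
  conn : ∀ {X Z : C} (_ : 𝓓.E.Grp Z X) (W : C), N.Grp W Z →+ (W ⟶ X)
  /-- `𝔼⁻¹(X, W) ⟶ Hom(Z, W)` for `δ ∈ 𝔼(Z, X)`. -/
  coconn : ∀ {X Z : C} (_ : 𝓓.E.Grp Z X) (W : C), N.Grp X W →+ (Z ⟶ W)
  conn_natural : ∀ {X Z W W' : C} (δ : 𝓓.E.Grp Z X) (w : W' ⟶ W) (χ : N.Grp W Z),
    conn δ W' (N.pull w χ) = w ≫ conn δ W χ
  coconn_natural : ∀ {X Z W W' : C} (δ : 𝓓.E.Grp Z X) (w : W ⟶ W') (χ : N.Grp X W),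
    coconn δ W' (N.push w χ) = coconn δ W χ ≫ w
  conn_hom : ∀ {X X' Z Z' : C} (δ : 𝓓.E.Grp Z X) (δ' : 𝓓.E.Grp Z' X') (a : X ⟶ X') (c : Z ⟶ Z'),
    𝓓.IsExtHom δ δ' a c → ∀ (W : C) (χ : N.Grp W Z),
      conn δ' W (N.push c χ) = conn δ W χ ≫ a
  coconn_hom : ∀ {X X' Z Z' : C} (δ : 𝓓.E.Grp Z X) (δ' : 𝓓.E.Grp Z' X') (a : X ⟶ X')
    (c : Z ⟶ Z'), 𝓓.IsExtHom δ δ' a c → ∀ (W : C) (χ : N.Grp X' W),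
      coconn δ W (N.pull a χ) = c ≫ coconn δ' W χ
  exact : ∀ {X Y Z : C} (δ : 𝓓.E.Grp Z X) (x : X ⟶ Y) (y : Y ⟶ Z), 𝓓.Realizes δ x y → ∀ W : C,
    Function.Exact (N.push (Z := W) x) (N.push (Z := W) y) ∧
    Function.Exact (N.push (Z := W) y) (conn δ W) ∧
    Function.Exact (conn δ W) (fun h : W ⟶ X => h ≫ x)
  coexact : ∀ {X Y Z : C} (δ : 𝓓.E.Grp Z X) (x : X ⟶ Y) (y : Y ⟶ Z), 𝓓.Realizes δ x y → ∀ W : C,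
    Function.Exact (N.pull (X := W) y) (N.pull (X := W) x) ∧
    Function.Exact (N.pull (X := W) x) (coconn δ W) ∧
    Function.Exact (coconn δ W) (fun h : Z ⟶ W => y ≫ h)

/-- Coproducts indexed by nonempty sets exist and
`𝔼⁻¹(∐ᵢ Yᵢ, X) ⟶ ∏ᵢ 𝔼⁻¹(Yᵢ, X)` is surjective. -/
def NegativeFirstExtension.CoproductCompatible {𝓓 : ExtData C}
    (𝓝 : 𝓓.NegativeFirstExtension) : Prop :=
  ∀ (I : Type v) [Nonempty I], ∃ _ : HasCoproductsOfShape I C, ∀ (X : C) (Y : I → C),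
    Function.Surjective fun (χ : 𝓝.N.Grp (∐ Y) X) (i : I) => 𝓝.N.pull (Limits.Sigma.ι Y i) χ

/-- Products indexed by nonempty sets exist and
`𝔼⁻¹(X, ∏ᵢ Yᵢ) ⟶ ∏ᵢ 𝔼⁻¹(X, Yᵢ)` is surjective. -/
def NegativeFirstExtension.ProductCompatible {𝓓 : ExtData C}
    (𝓝 : 𝓓.NegativeFirstExtension) : Prop :=
  ∀ (I : Type v) [Nonempty I], ∃ _ : HasProductsOfShape I C, ∀ (X : C) (Y : I → C),
    Function.Surjective fun (χ : 𝓝.N.Grp X (∏ᶜ Y)) (i : I) => 𝓝.N.push (Limits.Pi.π Y i) χ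

end ExtData

end Extri

/-! Embed `X` in a conflation `X ⟶ J ⟶ Z` with `J` injective. Every extension of `W` by `X` is then
pulled back from it, so `𝔼(W, X)` is the cokernel of `Hom(W, J) ⟶ Hom(W, Z)`. As `Hom` turns
coproducts in `W` into products, so does this cokernel (`bijective_pull_ι`). Hence condition (2)
determines `Γ`, and its existence, additivity and naturality are checked on each `Bᵢ`.

For condition (1), take any realization `A^(I) ⟶ E ⟶ ∐ Bᵢ` of `Γ(η)` and induced maps `φᵢ : Mᵢ ⟶ E`
from the middle terms of the `ηᵢ`. The point is that `E` is the coproduct of the `Mᵢ`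
(`existsUnique_desc`). A map out of `E` with given components exists because its obstruction in `𝔼(∐
Bᵢ, W)` vanishes on each `Bᵢ`. Uniqueness is where `𝔼⁻¹` enters: the elements of `𝔼⁻¹(A, W)` that
witness vanishing for each `i` must be glued to one element of `𝔼⁻¹(A^(I), W)`.

The second half is the first one applied to `Cᵒᵖ`; for this the axioms used are gathered in the
self-dual `IsWeak`. -/

namespace Extri

/-! ### Functoriality of pushing and pulling extensions -/

namespace AddBifunctor

variable {C : Type u} [Category.{v} C] [Preadditive C] (F : AddBifunctor.{v} C)

lemma push_comp {Z X X' X'' : C} (a : X ⟶ X') (b : X' ⟶ X'') (x : F.Grp Z X) :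
    F.push (a ≫ b) x = F.push b (F.push a x) := by
  simp [push]

lemma push_id {Z X : C} (x : F.Grp Z X) : F.push (𝟙 X) x = x := by
  simp [push]

lemma pull_comp {Z Z' Z'' X : C} (c : Z' ⟶ Z) (d : Z'' ⟶ Z') (x : F.Grp Z X) :
    F.pull (d ≫ c) x = F.pull d (F.pull c x) := by
  simp [pull]

lemma push_pull {Z Z' X X' : C} (a : X ⟶ X') (c : Z' ⟶ Z) (x : F.Grp Z X) :
    F.push a (F.pull c x) = F.pull c (F.push a x) :=
  (congrArg (fun t => t.hom x) ((F.functor.map c.op).naturality a)).symm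

lemma pull_sub {Z Z' X : C} (c d : Z' ⟶ Z) (x : F.Grp Z X) :
    F.pull (c - d) x = F.pull c x - F.pull d x := by
  have := F.additive_left
  simp [pull, Functor.map_sub]

end AddBifunctor

namespace ExtData

variable {C : Type u} [Category.{v} C] [Preadditive C]

/-- The part of the axioms of an extriangulated category that yields the six term exact sequences
of `Hom` and `𝔼`, in a self-dual form. -/
structure IsWeak (𝓓 : ExtData.{v} C) : Prop where
  realization : ∀ {X Y Z X' Y' Z' : C} {x : X ⟶ Y} {y : Y ⟶ Z} {x' : X' ⟶ Y'} {y' : Y' ⟶ Z'}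
    {δ : 𝓓.E.Grp Z X} {δ' : 𝓓.E.Grp Z' X'}, 𝓓.Realizes δ x y → 𝓓.Realizes δ' x' y' →
    ∀ (a : X ⟶ X') (c : Z ⟶ Z'), 𝓓.IsExtHom δ δ' a c →
      ∃ b : Y ⟶ Y', x ≫ b = a ≫ x' ∧ y ≫ c = b ≫ y'
  real_zero_left : ∀ (O Z : C), IsZero O → 𝓓.Realizes (0 : 𝓓.E.Grp Z O) 0 (𝟙 Z)
  real_zero_right : ∀ (X O : C), IsZero O → 𝓓.Realizes (0 : 𝓓.E.Grp O X) (𝟙 X) 0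
  et3 : ∀ {X Y Z X' Y' Z' : C} {x : X ⟶ Y} {y : Y ⟶ Z} {x' : X' ⟶ Y'} {y' : Y' ⟶ Z'}
    {δ : 𝓓.E.Grp Z X} {δ' : 𝓓.E.Grp Z' X'}, 𝓓.Realizes δ x y → 𝓓.Realizes δ' x' y' →
    ∀ (a : X ⟶ X') (b : Y ⟶ Y'), x ≫ b = a ≫ x' →
      ∃ c : Z ⟶ Z', 𝓓.IsExtHom δ δ' a c ∧ y ≫ c = b ≫ y'
  et3_op : ∀ {X Y Z X' Y' Z' : C} {x : X ⟶ Y} {y : Y ⟶ Z} {x' : X' ⟶ Y'} {y' : Y' ⟶ Z'}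
    {δ : 𝓓.E.Grp Z X} {δ' : 𝓓.E.Grp Z' X'}, 𝓓.Realizes δ x y → 𝓓.Realizes δ' x' y' →
    ∀ (b : Y ⟶ Y') (c : Z ⟶ Z'), y ≫ c = b ≫ y' →
      ∃ a : X ⟶ X', 𝓓.IsExtHom δ δ' a c ∧ x ≫ b = a ≫ x'

lemma exists_realizes (𝓓 : ExtData.{v} C) {X Z : C} (δ : 𝓓.E.Grp Z X) :
    ∃ (Y : C) (x : X ⟶ Y) (y : Y ⟶ Z), 𝓓.Realizes δ x y := by
  obtain ⟨S, hS⟩ := Quotient.exists_rep (𝓓.s δ)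
  exact ⟨S.mid, S.i, S.p, hS.symm⟩

lemma Realizes.of_iso {𝓓 : ExtData.{v} C} {X Y Y' Z : C} {δ : 𝓓.E.Grp Z X} {x : X ⟶ Y}
    {y : Y ⟶ Z} {x' : X ⟶ Y'} {y' : Y' ⟶ Z} (h : 𝓓.Realizes δ x y) (b : Y ≅ Y')
    (hx : x ≫ b.hom = x') (hy : b.hom ≫ y' = y) : 𝓓.Realizes δ x' y' :=
  h.trans (Quotient.sound ⟨b, hx, hy⟩)

namespace IsWeak

variable {𝓓 : ExtData.{v} C} {X Y Z : C} {δ : 𝓓.E.Grp Z X} {x : X ⟶ Y} {y : Y ⟶ Z}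

/-! ### Exactness of the `Hom`–`𝔼` sequences of a conflation -/

section

variable [HasZeroObject C]

open ZeroObject

/-- This and the next four lemmas compare the given conflation with `0 ⟶ W ⟶ W` or `W ⟶ W ⟶ 0`,
which realize zero. The missing component of the resulting morphism, or its compatibility with the
extensions, is the claim. -/
lemma exists_desc (h𝓓 : 𝓓.IsWeak) (h : 𝓓.Realizes δ x y) {W : C} (k : Y ⟶ W) (hk : x ≫ k = 0) :
    ∃ l : Z ⟶ W, y ≫ l = k := by
  obtain ⟨c, -, hc⟩ := h𝓓.et3 h (h𝓓.real_zero_left 0 W (isZero_zero C)) 0 k (by simp [hk])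
  exact ⟨c, by simpa using hc⟩

lemma exists_extend (h𝓓 : 𝓓.IsWeak) (h : 𝓓.Realizes δ x y) {W : C} (a : X ⟶ W)
    (ha : 𝓓.E.push a δ = 0) : ∃ b : Y ⟶ W, x ≫ b = a := by
  obtain ⟨b, hb, -⟩ := h𝓓.realization h (h𝓓.real_zero_right W 0 (isZero_zero C)) a 0
    (by simp [IsExtHom, ha])
  exact ⟨b, by simpa using hb⟩

lemma push_comp_eq_zero (h𝓓 : 𝓓.IsWeak) (h : 𝓓.Realizes δ x y) {W : C} (b : Y ⟶ W) :
    𝓓.E.push (x ≫ b) δ = 0 := by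
  obtain ⟨c, hc, -⟩ := h𝓓.et3 h (h𝓓.real_zero_right W 0 (isZero_zero C)) (x ≫ b) b (by simp)
  rw [hc, map_zero]

lemma exists_lift (h𝓓 : 𝓓.IsWeak) (h : 𝓓.Realizes δ x y) {W : C} (c : W ⟶ Z)
    (hc : 𝓓.E.pull c δ = 0) : ∃ b : W ⟶ Y, b ≫ y = c := by
  obtain ⟨b, -, hb⟩ := h𝓓.realization (h𝓓.real_zero_left 0 W (isZero_zero C)) h 0 c
    (by simp [IsExtHom, hc])
  exact ⟨b, by simpa using hb.symm⟩

lemma pull_comp_eq_zero (h𝓓 : 𝓓.IsWeak) (h : 𝓓.Realizes δ x y) {W : C} (b : W ⟶ Y) :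
    𝓓.E.pull (b ≫ y) δ = 0 := by
  obtain ⟨a, ha, -⟩ := h𝓓.et3_op (h𝓓.real_zero_left 0 W (isZero_zero C)) h b (b ≫ y) (by simp)
  rw [← ha, map_zero]

end

/-- Extensions by `X` are pulled back from any extension of `X` with injective middle term. -/
lemma exists_pull_eq (h𝓓 : 𝓓.IsWeak) (h : 𝓓.Realizes δ x y) (hY : 𝓓.IsInjective Y) {W : C}
    (η : 𝓓.E.Grp W X) : ∃ c : W ⟶ Z, 𝓓.E.pull c δ = η := by
  obtain ⟨M, f, g, hη⟩ := 𝓓.exists_realizes η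
  -- Injectivity of `Y` extends `x` along `f`; (ET3) with the identity on `X` then gives the
  -- classifying map `W ⟶ Z`.
  obtain ⟨b, hb⟩ := hY f g ⟨η, hη⟩ x
  obtain ⟨c, hc, -⟩ := h𝓓.et3 hη h (𝟙 X) b (by simpa using hb)
  exact ⟨c, by rw [← hc, 𝓓.E.push_id]⟩

/-! ### Extensions of a coproduct and their realizations -/

variable [HasZeroObject C] {I : Type v} [HasCoproductsOfShape I C]

/-- With enough injectives, `𝔼(∐ᵢ Bᵢ, X) ⟶ ∏ᵢ 𝔼(Bᵢ, X)` is bijective. -/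
lemma bijective_pull_ι (h𝓓 : 𝓓.IsWeak) (hI : 𝓓.EnoughInjectives) (B : I → C) (X : C) :
    Function.Bijective fun (η : 𝓓.E.Grp (∐ B) X) (i : I) => 𝓓.E.pull (Limits.Sigma.ι B i) η := by
  obtain ⟨J, Z, x, y, hJ, δ, hδ⟩ := hI X
  constructor
  · intro η η' hηη'
    obtain ⟨c, rfl⟩ := h𝓓.exists_pull_eq hδ hJ η
    obtain ⟨c', rfl⟩ := h𝓓.exists_pull_eq hδ hJ η'
    -- On each `Bᵢ` the difference `c - c'` pulls `δ` back to zero, so it lifts to `J`; the lifts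
    -- glue to a lift on the coproduct.
    have hl (i : I) : ∃ l : B i ⟶ J, l ≫ y = Limits.Sigma.ι B i ≫ (c - c') := by
      apply h𝓓.exists_lift hδ
      rw [𝓓.E.pull_comp, 𝓓.E.pull_sub, map_sub]
      exact sub_eq_zero.2 (congrFun hηη' i)
    choose l hl using hl
    have hc : c - c' = Limits.Sigma.desc l ≫ y := Limits.Sigma.hom_ext _ _ fun i => by simp [hl]
    rw [← sub_eq_zero, ← 𝓓.E.pull_sub, hc, h𝓓.pull_comp_eq_zero hδ]
  · intro η
    choose c hc using fun i => h𝓓.exists_pull_eq hδ hJ (η i)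
    refine ⟨𝓓.E.pull (Limits.Sigma.desc c) δ, funext fun i => ?_⟩
    dsimp only
    rw [← 𝓓.E.pull_comp, colimit.ι_desc]
    exact hc i

lemma ext_pull_ι (h𝓓 : 𝓓.IsWeak) (hI : 𝓓.EnoughInjectives) {B : I → C} {X : C}
    {η η' : 𝓓.E.Grp (∐ B) X}
    (h : ∀ i, 𝓓.E.pull (Limits.Sigma.ι B i) η = 𝓓.E.pull (Limits.Sigma.ι B i) η') : η = η' :=
  (h𝓓.bijective_pull_ι hI B X).injective (funext h)

/-- The extension of `∐ᵢ Bᵢ` by `A^(I)` whose restriction to each `Bᵢ` is the pushout of the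
given extension along the inclusion of `A`. -/
noncomputable def coproductExt (h𝓓 : 𝓓.IsWeak) (hI : 𝓓.EnoughInjectives) (B : I → C) (A : C)
    (η : ∀ i, 𝓓.E.Grp (B i) A) : 𝓓.E.Grp (∐ B) (∐ fun _ : I => A) :=
  ((h𝓓.bijective_pull_ι hI B _).surjective
    fun i => 𝓓.E.push (Limits.Sigma.ι (fun _ : I => A) i) (η i)).choose

lemma pull_ι_coproductExt (h𝓓 : 𝓓.IsWeak) (hI : 𝓓.EnoughInjectives) (B : I → C) (A : C)
    (η : ∀ i, 𝓓.E.Grp (B i) A) (i : I) :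
    𝓓.E.pull (Limits.Sigma.ι B i) (h𝓓.coproductExt hI B A η) =
      𝓓.E.push (Limits.Sigma.ι (fun _ : I => A) i) (η i) :=
  congrFun ((h𝓓.bijective_pull_ι hI B _).surjective
    fun i => 𝓓.E.push (Limits.Sigma.ι (fun _ : I => A) i) (η i)).choose_spec i

/-- Let `Γ` be an extension of `∐ᵢ Bᵢ` by `A^(I)` to which the coproduct inclusions give morphisms
of extensions from the `ηᵢ`. Then the middle term of `Γ` is a coproduct of those of the `ηᵢ`. -/
lemma existsUnique_desc (h𝓓 : 𝓓.IsWeak) (hI : 𝓓.EnoughInjectives) (𝓝 : 𝓓.NegativeFirstExtension)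
    {A : C}
    (h𝓝 : ∀ W : C, Function.Surjective fun (χ : 𝓝.N.Grp (∐ fun _ : I => A) W) (i : I) =>
      𝓝.N.pull (Limits.Sigma.ι (fun _ : I => A) i) χ)
    {B M : I → C} {η : ∀ i, 𝓓.E.Grp (B i) A} {f : ∀ i, A ⟶ M i} {g : ∀ i, M i ⟶ B i}
    (hη : ∀ i, 𝓓.Realizes (η i) (f i) (g i)) {Γ : 𝓓.E.Grp (∐ B) (∐ fun _ : I => A)}
    (hηΓ : ∀ i, 𝓓.IsExtHom (η i) Γ (Limits.Sigma.ι (fun _ : I => A) i) (Limits.Sigma.ι B i))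
    {E : C} {F : (∐ fun _ : I => A) ⟶ E} {G : E ⟶ ∐ B} (hΓ : 𝓓.Realizes Γ F G)
    {φ : ∀ i, M i ⟶ E} (hF : ∀ i, f i ≫ φ i = Limits.Sigma.ι (fun _ : I => A) i ≫ F)
    (hG : ∀ i, g i ≫ Limits.Sigma.ι B i = φ i ≫ G) {W : C} (t : ∀ i, M i ⟶ W) :
    ∃! h : E ⟶ W, ∀ i, φ i ≫ h = t i := by
  -- A map `h` killed by all `φᵢ` is `G ≫ k`, and each `ι ≫ k` comes from some `χᵢ` in `𝔼⁻¹(A, W)`.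
  -- Gluing the `χᵢ` to `ψ` exhibits `k` as a connecting image, whence `G ≫ k = 0`.
  have huniq (h : E ⟶ W) (hh : ∀ i, φ i ≫ h = 0) : h = 0 := by
    obtain ⟨k, rfl⟩ := h𝓓.exists_desc hΓ h
      (Limits.Sigma.hom_ext _ _ fun i => by
        rw [← Category.assoc, ← hF, Category.assoc, hh, comp_zero, comp_zero])
    have hχ (i : I) : ∃ χ, 𝓝.coconn (η i) W χ = Limits.Sigma.ι B i ≫ k :=
      ((𝓝.coexact (η i) (f i) (g i) (hη i) W).2.2 _).1 (by
        dsimp only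
        rw [← Category.assoc, hG, Category.assoc, hh])
    choose χ hχ using hχ
    obtain ⟨ψ, hψ⟩ := h𝓝 W χ
    refine ((𝓝.coexact Γ F G hΓ W).2.2 k).2 ⟨ψ, Limits.Sigma.hom_ext _ _ fun i => ?_⟩
    rw [← 𝓝.coconn_hom (η i) Γ _ _ (hηΓ i) W ψ, ← hχ i]
    exact congrArg _ (congrFun hψ i)
  -- The prescribed map on `A^(I)` extends to `E` once it pushes `Γ` to zero. On `Bᵢ` this reads
  -- `(fᵢ ≫ tᵢ) · ηᵢ = 0`.
  obtain ⟨h', hh'⟩ := h𝓓.exists_extend hΓ (Limits.Sigma.desc fun i => f i ≫ t i) (by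
    refine h𝓓.ext_pull_ι hI fun i => ?_
    rw [← 𝓓.E.push_pull, ← hηΓ i, ← 𝓓.E.push_comp, colimit.ι_desc, map_zero]
    exact h𝓓.push_comp_eq_zero (hη i) (t i))
  -- `φᵢ ≫ h'` agrees with `tᵢ` only after precomposition with `fᵢ`. The error therefore factors
  -- through `gᵢ`, and the factors glue to a correction on `∐ Bᵢ`.
  have hk (i : I) : ∃ k : B i ⟶ W, g i ≫ k = t i - φ i ≫ h' := by
    apply h𝓓.exists_desc (hη i)
    rw [Preadditive.comp_sub, ← Category.assoc, hF, Category.assoc, hh', colimit.ι_desc]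
    exact sub_self _
  choose k hk using hk
  have hex (i : I) : φ i ≫ (h' + G ≫ Limits.Sigma.desc k) = t i := by
    rw [Preadditive.comp_add, ← Category.assoc (φ i) G, ← hG, Category.assoc, colimit.ι_desc]
    simp [hk]
  refine ⟨_, hex, fun h hh => sub_eq_zero.1 (huniq _ fun i => ?_)⟩
  rw [Preadditive.comp_sub, hh, hex, sub_self]

/-- If the coproduct inclusions induce surjections on `𝔼⁻¹`, an extension to which the coproduct
inclusions are morphisms of extensions is realized by the coproduct of realizations. -/
lemma realizes_sigmaMap (h𝓓 : 𝓓.IsWeak) (hI : 𝓓.EnoughInjectives) (𝓝 : 𝓓.NegativeFirstExtension)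
    {A : C}
    (h𝓝 : ∀ W : C, Function.Surjective fun (χ : 𝓝.N.Grp (∐ fun _ : I => A) W) (i : I) =>
      𝓝.N.pull (Limits.Sigma.ι (fun _ : I => A) i) χ)
    {B M : I → C} {η : ∀ i, 𝓓.E.Grp (B i) A} {f : ∀ i, A ⟶ M i} {g : ∀ i, M i ⟶ B i}
    (hη : ∀ i, 𝓓.Realizes (η i) (f i) (g i)) {Γ : 𝓓.E.Grp (∐ B) (∐ fun _ : I => A)}
    (hηΓ : ∀ i, 𝓓.IsExtHom (η i) Γ (Limits.Sigma.ι (fun _ : I => A) i) (Limits.Sigma.ι B i)) :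
    𝓓.Realizes Γ (Limits.Sigma.map f) (Limits.Sigma.map g) := by
  obtain ⟨E, F, G, hΓ⟩ := 𝓓.exists_realizes Γ
  choose φ hF hG using fun i => h𝓓.realization (hη i) hΓ _ _ (hηΓ i)
  have key {W : C} (t : ∀ i, M i ⟶ W) : ∃! h : E ⟶ W, ∀ i, φ i ≫ h = t i :=
    h𝓓.existsUnique_desc hI 𝓝 h𝓝 hη hηΓ hΓ hF hG t
  obtain ⟨ψ, hψ, -⟩ := key (Limits.Sigma.ι M)
  have hom_inv : ψ ≫ Limits.Sigma.desc φ = 𝟙 E :=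
    (key φ).unique (fun i => by rw [← Category.assoc, hψ, colimit.ι_desc]; rfl)
      (fun i => Category.comp_id _)
  let e : E ≅ ∐ M :=
    { hom := ψ
      inv := Limits.Sigma.desc φ
      hom_inv_id := hom_inv
      inv_hom_id := Limits.Sigma.hom_ext _ _ fun i => by simp [hψ] }
  refine hΓ.of_iso e ?_ ?_
  · refine Limits.Sigma.hom_ext _ _ fun i => ?_
    rw [← Category.assoc, ← hF, Category.assoc, hψ]
    simp
  · refine (key fun i => φ i ≫ G).unique (fun i => ?_) fun i => rfl
    rw [← Category.assoc, hψ, ← hG]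
    simp

theorem isAET4 (h𝓓 : 𝓓.IsWeak) (𝓝 : 𝓓.NegativeFirstExtension) (h𝓝 : 𝓝.CoproductCompatible)
    (hI : 𝓓.EnoughInjectives) : 𝓓.IsAET4 := by
  intro I _
  obtain ⟨hcop, hsurj⟩ := h𝓝 I
  refine ⟨hcop, fun B A => AddMonoidHom.mk' (h𝓓.coproductExt hI B A) fun η η' => ?_,
    fun B B' A A' b a η => ?_, fun B A η M f g h => ?_, fun B A η i => ?_⟩
  · refine h𝓓.ext_pull_ι hI fun i => ?_
    rw [map_add]
    simp only [h𝓓.pull_ι_coproductExt hI]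
    exact map_add _ _ _
  -- Both sides of the naturality square restrict on `B'ᵢ` to `ηᵢ` pulled back along `bᵢ` and pushed
  -- along `a` followed by the inclusion.
  · refine h𝓓.ext_pull_ι hI fun i => ?_
    change 𝓓.E.pull _ (h𝓓.coproductExt hI _ _ _) =
      𝓓.E.pull _ (𝓓.E.push _ (𝓓.E.pull _ (h𝓓.coproductExt hI _ _ _)))
    rw [h𝓓.pull_ι_coproductExt hI, ← 𝓓.E.push_pull, ← 𝓓.E.pull_comp, Limits.Sigma.ι_map,
      𝓓.E.pull_comp, h𝓓.pull_ι_coproductExt hI, ← 𝓓.E.push_pull, ← 𝓓.E.push_comp,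
      ← 𝓓.E.push_comp, Limits.Sigma.ι_map]
  · exact h𝓓.realizes_sigmaMap hI 𝓝 (fun W => hsurj W _) h
      fun i => (h𝓓.pull_ι_coproductExt hI B A η i).symm
  · exact h𝓓.pull_ι_coproductExt hI B A η i

end IsWeak

/-! ### Passage to the opposite category -/

section Opposites

lemma realizes_op_iff (𝓓 : ExtData.{v} C) {X Y Z : Cᵒᵖ} (δ : 𝓓.E.Grp X.unop Z.unop) (x : X ⟶ Y)
    (y : Y ⟶ Z) : 𝓓.op.Realizes (Z := Z) (X := X) δ x y ↔ 𝓓.Realizes δ y.unop x.unop := by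
  constructor
  · intro h
    -- A representative of `s δ` makes the equality of classes in `Cᵒᵖ` an isomorphism of middle
    -- terms, which can be reversed.
    obtain ⟨M, f, g, hδ⟩ := 𝓓.exists_realizes δ
    have h' : seqClass g.op f.op = seqClass x y :=
      (congrArg SeqClass.op hδ).symm.trans h
    obtain ⟨b, hb, hb'⟩ := Quotient.exact h'
    refine hδ.of_iso b.unop.symm ?_ ?_
    · exact ((Iso.comp_inv_eq b.unop).2 (congrArg Quiver.Hom.unop hb').symm)
    · exact ((Iso.inv_comp_eq b.unop).2 (congrArg Quiver.Hom.unop hb).symm)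
  · intro h
    exact congrArg SeqClass.op h

lemma isConflation_op_iff (𝓓 : ExtData.{v} C) {X Y Z : Cᵒᵖ} (x : X ⟶ Y) (y : Y ⟶ Z) :
    𝓓.op.IsConflation x y ↔ 𝓓.IsConflation y.unop x.unop :=
  exists_congr fun δ => 𝓓.realizes_op_iff δ x y

lemma isExtHom_op_iff (𝓓 : ExtData.{v} C) {X X' Z Z' : Cᵒᵖ} (δ : 𝓓.E.Grp X.unop Z.unop)
    (δ' : 𝓓.E.Grp X'.unop Z'.unop) (a : X ⟶ X') (c : Z ⟶ Z') :
    𝓓.op.IsExtHom (X := X) (X' := X') (Z := Z) (Z' := Z') δ δ' a c ↔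
      𝓓.IsExtHom δ' δ c.unop a.unop :=
  eq_comm

lemma IsWeak.op {𝓓 : ExtData.{v} C} (h𝓓 : 𝓓.IsWeak) : 𝓓.op.IsWeak where
  realization := by
    intro X Y Z X' Y' Z' x y x' y' δ δ' h h' a c hac
    replace h := (𝓓.realizes_op_iff _ _ _).1 h
    replace h' := (𝓓.realizes_op_iff _ _ _).1 h'
    obtain ⟨b, hb, hb'⟩ := h𝓓.realization h' h c.unop a.unop ((𝓓.isExtHom_op_iff _ _ _ _).1 hac)
    exact ⟨b.op, congrArg Quiver.Hom.op hb'.symm, congrArg Quiver.Hom.op hb.symm⟩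
  real_zero_left O Z hO := (𝓓.realizes_op_iff _ _ _).2 (h𝓓.real_zero_right Z.unop O.unop hO.unop)
  real_zero_right X O hO := (𝓓.realizes_op_iff _ _ _).2 (h𝓓.real_zero_left O.unop X.unop hO.unop)
  et3 := by
    intro X Y Z X' Y' Z' x y x' y' δ δ' h h' a b hab
    replace h := (𝓓.realizes_op_iff _ _ _).1 h
    replace h' := (𝓓.realizes_op_iff _ _ _).1 h'
    obtain ⟨c, hc, hc'⟩ := h𝓓.et3_op h' h b.unop a.unop (congrArg Quiver.Hom.unop hab).symm
    exact ⟨c.op, (𝓓.isExtHom_op_iff _ _ _ _).2 hc, congrArg Quiver.Hom.op hc'.symm⟩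
  et3_op := by
    intro X Y Z X' Y' Z' x y x' y' δ δ' h h' b c hbc
    replace h := (𝓓.realizes_op_iff _ _ _).1 h
    replace h' := (𝓓.realizes_op_iff _ _ _).1 h'
    obtain ⟨a, ha, ha'⟩ := h𝓓.et3 h' h c.unop b.unop (congrArg Quiver.Hom.unop hbc).symm
    exact ⟨a.op, (𝓓.isExtHom_op_iff _ _ _ _).2 ha, congrArg Quiver.Hom.op ha'.symm⟩

lemma IsProjective.op {𝓓 : ExtData.{v} C} {P : C} (hP : 𝓓.IsProjective P) :
    𝓓.op.IsInjective (Opposite.op P) := by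
  intro X Y Z i p h a
  obtain ⟨b, hb⟩ := hP _ _ ((𝓓.isConflation_op_iff i p).1 h) a.unop
  exact ⟨b.op, congrArg Quiver.Hom.op hb⟩

lemma EnoughProjectives.op {𝓓 : ExtData.{v} C} (h : 𝓓.EnoughProjectives) :
    𝓓.op.EnoughInjectives := by
  intro X
  obtain ⟨K, P, i, p, hP, hip⟩ := h X.unop
  exact ⟨Opposite.op P, Opposite.op K, p.op, i.op, hP.op, (𝓓.isConflation_op_iff _ _).2 hip⟩

namespace NegativeFirstExtension

variable {𝓓 : ExtData.{v} C} (𝓝 : 𝓓.NegativeFirstExtension)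

/-- The opposite negative first extension, which exchanges the two connecting morphisms. -/
def op : 𝓓.op.NegativeFirstExtension where
  N := 𝓝.N.op
  conn {X Z} δ W :=
    (opHom X.unop W.unop).comp (𝓝.coconn (X := Z.unop) (Z := X.unop) δ W.unop)
  coconn {X Z} δ W :=
    (opHom W.unop Z.unop).comp (𝓝.conn (X := Z.unop) (Z := X.unop) δ W.unop)
  conn_natural δ w χ := congrArg Quiver.Hom.op (𝓝.coconn_natural δ w.unop χ)
  coconn_natural δ w χ := congrArg Quiver.Hom.op (𝓝.conn_natural δ w.unop χ)
  conn_hom δ δ' a c h W χ := congrArg Quiver.Hom.op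
    (𝓝.coconn_hom δ' δ c.unop a.unop ((𝓓.isExtHom_op_iff _ _ _ _).1 h) W.unop χ)
  coconn_hom δ δ' a c h W χ := congrArg Quiver.Hom.op
    (𝓝.conn_hom δ' δ c.unop a.unop ((𝓓.isExtHom_op_iff _ _ _ _).1 h) W.unop χ)
  exact δ x y h W := by
    obtain ⟨h₁, h₂, h₃⟩ := 𝓝.coexact δ y.unop x.unop ((𝓓.realizes_op_iff δ x y).1 h) W.unop
    refine ⟨h₁, fun χ => ?_, fun k => ?_⟩
    · exact Quiver.Hom.op_inj.eq_iff.trans (h₂ χ)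
    · refine Quiver.Hom.unop_inj.eq_iff.symm.trans ((h₃ k.unop).trans ?_)
      exact exists_congr fun χ => Quiver.Hom.op_inj.eq_iff.symm
  coexact δ x y h W := by
    obtain ⟨h₁, h₂, h₃⟩ := 𝓝.exact δ y.unop x.unop ((𝓓.realizes_op_iff δ x y).1 h) W.unop
    refine ⟨h₁, fun χ => ?_, fun k => ?_⟩
    · exact Quiver.Hom.op_inj.eq_iff.trans (h₂ χ)
    · refine Quiver.Hom.unop_inj.eq_iff.symm.trans ((h₃ k.unop).trans ?_)
      exact exists_congr fun χ => Quiver.Hom.op_inj.eq_iff.symm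

variable {𝓝}

lemma ProductCompatible.op (h : 𝓝.ProductCompatible) : 𝓝.op.CoproductCompatible := by
  intro I _
  obtain ⟨hprod, hsurj⟩ := h I
  refine ⟨inferInstance, fun X Y χ => ?_⟩
  obtain ⟨ψ, hψ⟩ := hsurj X.unop (fun i => (Y i).unop) χ
  let e := opProductIsoCoproduct fun i => (Y i).unop
  -- The chosen coproduct in `Cᵒᵖ` is only isomorphic to the opposite of the product in `C`, so `ψ`
  -- is transported along `e`.
  refine ⟨𝓝.op.N.pull e.inv ψ, funext fun i => ?_⟩
  have he : Limits.Sigma.ι Y i ≫ e.inv = (Pi.π (fun i => (Y i).unop) i).op :=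
    (Iso.comp_inv_eq e).2 (π_comp_opProductIsoCoproduct_hom _ i).symm
  refine (𝓝.op.N.pull_comp _ _ _).symm.trans ?_
  rw [he]
  exact congrFun hψ i

end NegativeFirstExtension

end Opposites

end ExtData

/-- If one summand is zero, the biproduct in the split sequence is isomorphic to the other summand.
-/
lemma Extriangulated.isWeak {C : Type u} [Category.{v} C] [Preadditive C] [HasZeroObject C]
    [HasBinaryBiproducts C] (𝓔 : Extriangulated.{v} C) : 𝓔.toExtData.IsWeak where
  realization := 𝓔.realization
  real_zero_left O Z hO := (𝓔.real_zero O Z).of_iso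
    { hom := biprod.snd
      inv := biprod.inr
      hom_inv_id := biprod.hom_ext' _ _ (hO.eq_of_src _ _) (by simp) } (by simp) (by simp)
  real_zero_right X O hO := (𝓔.real_zero X O).of_iso
    { hom := biprod.fst
      inv := biprod.inl
      hom_inv_id := biprod.hom_ext' _ _ (by simp) (hO.eq_of_src _ _) } (by simp)
      (hO.eq_of_tgt _ _)
  et3 := 𝓔.et3
  et3_op := 𝓔.et3_op

end Extri

theorem mainTheorem10 {C : Type u} [Category.{v} C] [Preadditive C] [HasZeroObject C]
    [HasBinaryBiproducts C] (𝓔 : Extri.Extriangulated.{v} C)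
    (𝓝 : 𝓔.toExtData.NegativeFirstExtension) :
    (𝓝.CoproductCompatible → 𝓔.toExtData.EnoughInjectives → 𝓔.toExtData.IsAET4) ∧
    (𝓝.ProductCompatible → 𝓔.toExtData.EnoughProjectives → 𝓔.toExtData.IsAET4Star) :=
  ⟨𝓔.isWeak.isAET4 𝓝, fun h hP => 𝓔.isWeak.op.isAET4 𝓝.op h.op hP.op⟩
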